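/- Let $R>0$ and $\omega,\sigma\in\mathbb{C}$ with $\operatorname{Im}(\sigma\omega)>0$ and $\sigma\notin(-\infty,0]$. For $n\ge 0$ let $\phi_n(x)=e^{-x}L_n(2x)$, where $L_n(x)=\sum_{k=0}^n\binom{n}{k}\frac{(-x)^k}{k!}$ is the $n$-th Laguerre polynomial; let $X_N=\operatorname{span}_{\mathbb{C}}\{\phi_0,\dots,\phi_N\}$, and let $h_0(z)=-\frac{i}{z}e^{iz}$ be the zeroth spherical Hankel function of the first kind. Then there are constants $c_1,c_2>0$ (which may depend on $R,\omega,\sigma$, but not on $N$) such that, for all integers $N\ge 0$, $$\inf_{u\in X_N}\bigl\|h_0(\omega(R+\sigma\,\cdot\,))-u\bigr\|_{L^2(\mathbb{R}_{\ge 0})}\le c_1\left|\frac{1+i\sigma\omega}{1-i\sigma\omega}\right|^{N+1}+c_2\exp\left(-2\operatorname{Re}\sqrt{\frac{2R(N+1)}{\sigma}}\right),$$ where the square root is the principal one. -/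

import Mathlib

open MeasureTheory
open scoped ENNReal

noncomputable section

/-- The Laguerre polynomial `L_n(x) = ∑_{k=0}^n (n choose n-k) (-x)^k / k!`. -/
def laguerrePoly (n : ℕ) (x : ℝ) : ℝ :=
  ∑ k ∈ Finset.range (n + 1), (n.choose (n - k) : ℝ) * (-x) ^ k / (k.factorial : ℝ)

/-- The Laguerre function `φ_n(x) = exp(-x) L_n(2x)`, as a complex-valued function. -/
def laguerreFun (n : ℕ) (x : ℝ) : ℂ :=
  ((Real.exp (-x) * laguerrePoly n (2 * x) : ℝ) : ℂ)

/-- The radial discrete space, the complex span of `φ_0, …, φ_N`. -/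
def radialSpace (N : ℕ) : Submodule ℂ (ℝ → ℂ) :=
  Submodule.span ℂ {f | ∃ n : ℕ, n ≤ N ∧ f = laguerreFun n}

/-- The spherical Hankel function of the first kind of order `ν`,
`h_ν(z) = -(i/z) exp(iz) (-i)^ν ∑_{m=0}^ν i^m / (m! (2z)^m) · (ν+m)!/(ν-m)!`, for `z ≠ 0`. -/
def sphericalHankel (ν : ℕ) (z : ℂ) : ℂ :=
  -(Complex.I / z) * Complex.exp (Complex.I * z) *
    ((-Complex.I) ^ ν * ∑ m ∈ Finset.range (ν + 1),
      Complex.I ^ m / ((m.factorial : ℂ) * (2 * z) ^ m) *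
        (((ν + m).factorial : ℂ) / ((ν - m).factorial : ℂ)))

/-- The best-approximation error `inf_{u ∈ X_N} ‖f - u‖` in `L²(ℝ_{≥0})`, with values in
`[0, ∞]` (a difference that is not square integrable has norm `∞`). -/
def bestApproxError (N : ℕ) (f : ℝ → ℂ) : ℝ≥0∞ :=
  ⨅ u ∈ radialSpace N, eLpNorm (fun x => f x - u x) 2 (volume.restrict (Set.Ici (0 : ℝ)))

end

/-! Put `r = R/σ`, `s = -iσω`, `y = r + x`. The function to approximate is a constant times `exp(-s
y)/y`, which is an integral of exponentials `exp(-p y)` over a path in the right half-plane from `s`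
to infinity. For a single exponential, the Laplace transform of `φ_n` shows that the projection
error onto `X_N` is exactly `|(p-1)/(p+1)|^(N+1) / √(2 Re p)` (`lintegral_enorm_expResidual_sq`).
Minkowski's integral inequality then bounds the whole error by the integral of these errors along
the path (`exists_radialSpace_eLpNorm_le`).

With `β = √r`, the path is the segment from `s` to `1/β` followed by the ray `p = t²/β`, `t ≥ 1`. On
the segment the factor stays below some `exp(-κ)`, so its contribution is exponentially small in `N`
(`exists_radialSpace_segment_le`). On the ray the size is governed by `exp(-Re(p r + 2(N+1)/p))`,
whose saddle point `p = √(2(N+1))/β` lies on this same ray for every `N`. A Gaussian estimate about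
it gives `exp(-2 Re β √(2(N+1)))` (`exists_radialSpace_ray_le`), which is the second term of the
bound. As the segment part is absorbed there too, `c₁` can be any positive number. -/

/-! ### Moments of complex exponentials on the half-line -/

theorem norm_pow_mul_cexp_neg (k : ℕ) (c : ℂ) {x : ℝ} (hx : 0 ≤ x) :
    ‖(x : ℂ) ^ k * Complex.exp (-(c * x))‖ = x ^ k * Real.exp (-c.re * x) := by
  rw [norm_mul, norm_pow, Complex.norm_real, Complex.norm_exp, Real.norm_of_nonneg hx]
  simp

theorem integrable_pow_mul_cexp_neg (k : ℕ) {c : ℂ} (hc : 0 < c.re) :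
    IntegrableOn (fun x : ℝ => (x : ℂ) ^ k * Complex.exp (-(c * x))) (Set.Ioi 0) := by
  have h := integrableOn_rpow_mul_exp_neg_mul_rpow (s := k) (p := 1) (b := c.re)
    (by have := k.cast_nonneg (α := ℝ); linarith) zero_lt_one hc
  refine h.mono' (by fun_prop) ?_
  filter_upwards [ae_restrict_mem measurableSet_Ioi] with x hx
  rw [norm_pow_mul_cexp_neg k c (le_of_lt hx)]
  simp

theorem tendsto_pow_mul_cexp_neg (k : ℕ) {c : ℂ} (hc : 0 < c.re) :
    Filter.Tendsto (fun x : ℝ => (x : ℂ) ^ k * Complex.exp (-(c * x))) Filter.atTop (nhds 0) := by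
  rw [tendsto_zero_iff_norm_tendsto_zero]
  refine (tendsto_rpow_mul_exp_neg_mul_atTop_nhds_zero k c.re hc).congr' ?_
  filter_upwards [Filter.eventually_ge_atTop 0] with x hx
  rw [norm_pow_mul_cexp_neg k c hx, Real.rpow_natCast]

theorem integral_pow_mul_cexp_neg (k : ℕ) {c : ℂ} (hc : 0 < c.re) :
    ∫ x in Set.Ioi (0 : ℝ), (x : ℂ) ^ k * Complex.exp (-(c * x)) = k.factorial / c ^ (k + 1) := by
  have hc0 : c ≠ 0 := by rintro rfl; simp at hc
  have hexp : ∀ x : ℝ, HasDerivAt (fun x : ℝ => Complex.exp (-(c * x)))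
      (Complex.exp (-(c * x)) * -(c * 1)) x := fun x =>
    (((hasDerivAt_id x).ofReal_comp.const_mul c).neg).cexp
  induction k with
  | zero =>
    have hi : IntegrableOn (fun x : ℝ => Complex.exp (-(c * x))) (Set.Ioi 0) := by
      simpa using integrable_pow_mul_cexp_neg 0 hc
    have h := integral_Ioi_of_hasDerivAt_of_tendsto' (a := 0) (fun x _ => hexp x)
      (hi.mul_const _)
      (by simpa using tendsto_pow_mul_cexp_neg 0 hc)
    rw [integral_mul_const] at h
    simp only [pow_zero, one_mul, Nat.factorial_zero, Nat.cast_one, zero_add, pow_one]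
    rw [eq_div_iff hc0]
    simp only [mul_one, Complex.ofReal_zero, mul_zero, neg_zero, Complex.exp_zero, zero_sub] at h
    linear_combination -h
  | succ k ih =>
    have hd : ∀ x ∈ Set.Ici (0 : ℝ), HasDerivAt
        (fun x : ℝ => (x : ℂ) ^ (k + 1) * Complex.exp (-(c * x)))
        ((k + 1) * ((x : ℂ) ^ k * Complex.exp (-(c * x))) -
          c * ((x : ℂ) ^ (k + 1) * Complex.exp (-(c * x)))) x := fun x _ => by
      have := ((hasDerivAt_id x).ofReal_comp.pow (k + 1)).mul (hexp x)
      refine this.congr_deriv ?_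
      simp only [id, Nat.add_sub_cancel, Pi.pow_apply]
      push_cast
      ring
    have h1 := (integrable_pow_mul_cexp_neg k hc).const_mul ((k : ℂ) + 1)
    have h2 := (integrable_pow_mul_cexp_neg (k + 1) hc).const_mul c
    have h := integral_Ioi_of_hasDerivAt_of_tendsto' hd (h1.sub h2)
      (tendsto_pow_mul_cexp_neg (k + 1) hc)
    rw [integral_sub h1 h2, integral_const_mul, integral_const_mul, ih] at h
    simp only [Complex.ofReal_zero, ne_eq, Nat.add_eq_zero_iff, one_ne_zero, and_false,
      not_false_eq_true, zero_pow, zero_mul, sub_zero] at h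
    rw [eq_div_iff (pow_ne_zero _ hc0)]
    rw [Nat.factorial_succ]
    push_cast
    field_simp at h
    linear_combination -h

/-! ### Laguerre functions: Laplace transform and orthogonality -/

theorem laguerreFun_eq_sum (n : ℕ) (x : ℝ) :
    laguerreFun n x = ∑ k ∈ Finset.range (n + 1),
      ((n.choose k : ℂ) * (-2) ^ k / k.factorial) * ((x : ℂ) ^ k * Complex.exp (-x)) := by
  unfold laguerreFun laguerrePoly
  push_cast
  rw [Finset.mul_sum]
  refine Finset.sum_congr rfl fun k hk => ?_
  rw [Nat.choose_symm (by simpa [Nat.lt_succ_iff] using hk)]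
  rw [show (-(2 * (x : ℂ))) = (-2) * x by ring, mul_pow]
  ring

theorem conj_laguerreFun (n : ℕ) (x : ℝ) :
    (starRingEnd ℂ) (laguerreFun n x) = laguerreFun n x := Complex.conj_ofReal _

theorem continuous_laguerreFun (n : ℕ) : Continuous (laguerreFun n) := by
  unfold laguerreFun laguerrePoly
  fun_prop

theorem pow_mul_cexp_mul_laguerreFun (n m : ℕ) (c : ℂ) (x : ℝ) :
    (x : ℂ) ^ m * Complex.exp (-(c * x)) * laguerreFun n x = ∑ k ∈ Finset.range (n + 1),
      ((n.choose k : ℂ) * (-2) ^ k / k.factorial) *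
        ((x : ℂ) ^ (k + m) * Complex.exp (-((c + 1) * x))) := by
  rw [laguerreFun_eq_sum, Finset.mul_sum]
  refine Finset.sum_congr rfl fun k _ => ?_
  rw [show -((c + 1) * (x : ℂ)) = -(c * x) + -x by ring, Complex.exp_add]
  ring

theorem integrable_pow_mul_cexp_mul_laguerreFun (n m : ℕ) {c : ℂ} (hc : 0 < (c + 1).re) :
    IntegrableOn (fun x : ℝ => (x : ℂ) ^ m * Complex.exp (-(c * x)) * laguerreFun n x)
      (Set.Ioi 0) := by
  simp_rw [pow_mul_cexp_mul_laguerreFun]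
  exact integrable_finsetSum _ fun k _ => (integrable_pow_mul_cexp_neg (k + m) hc).const_mul _

theorem integral_pow_mul_cexp_mul_laguerreFun (n m : ℕ) {c : ℂ} (hc : 0 < (c + 1).re) :
    ∫ x in Set.Ioi (0 : ℝ), (x : ℂ) ^ m * Complex.exp (-(c * x)) * laguerreFun n x =
      ∑ k ∈ Finset.range (n + 1), ((n.choose k : ℂ) * (-2) ^ k / k.factorial) *
        ((k + m).factorial / (c + 1) ^ (k + m + 1)) := by
  simp_rw [pow_mul_cexp_mul_laguerreFun]
  rw [integral_finsetSum _ fun k _ => (integrable_pow_mul_cexp_neg (k + m) hc).const_mul _]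
  refine Finset.sum_congr rfl fun k _ => ?_
  rw [integral_const_mul, integral_pow_mul_cexp_neg (k + m) hc]

/-- The Laplace transform of a Laguerre function. -/
theorem integral_cexp_mul_laguerreFun (n : ℕ) {p : ℂ} (hp : 0 < p.re) :
    ∫ x in Set.Ioi (0 : ℝ), Complex.exp (-(p * x)) * laguerreFun n x =
      (p - 1) ^ n / (p + 1) ^ (n + 1) := by
  have hp1 : 0 < (p + 1).re := by simp; linarith
  have h0 : p + 1 ≠ 0 := by intro h; simp [h] at hp1
  have h := integral_pow_mul_cexp_mul_laguerreFun n 0 hp1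
  simp only [pow_zero, one_mul, add_zero] at h
  rw [h]
  -- In this form the sum over `k` is a binomial expansion.
  have : (p - 1) ^ n / (p + 1) ^ (n + 1) = (-2 / (p + 1) + 1) ^ n / (p + 1) := by
    rw [show -2 / (p + 1) + 1 = (p - 1) / (p + 1) by field_simp; ring, div_pow, div_div, pow_succ]
  rw [this, add_pow, Finset.sum_div]
  refine Finset.sum_congr rfl fun k _ => ?_
  have hk : (k.factorial : ℂ) ≠ 0 := by exact_mod_cast k.factorial_ne_zero
  rw [div_pow, pow_succ, one_pow]
  field_simp

/-- Up to sign this is the `n`-th forward difference, taken at `k`, of the degree-`k` polynomial `x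
↦ x.choose k`. It gives the orthogonality of `φ_n` to `x^m exp(-x)` for `m < n`. -/
theorem alternating_sum_choose_mul_choose {n k : ℕ} (h : k ≤ n) :
    ∑ j ∈ Finset.range (n + 1), (-1 : ℤ) ^ j * n.choose j * (j + k).choose k =
      if k = n then (-1 : ℤ) ^ n else 0 := by
  have h1 := fwdDiff_iter_eq_sum_shift (M := ℕ) (G := ℤ) 1 (fun x => (x.choose k : ℤ)) n k
  have h2 : (fwdDiff 1)^[n] (fun x : ℕ => (x.choose k : ℤ)) k = if k = n then 1 else 0 := by
    have h3 := fwdDiff_iter_choose 0 k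
    simp only [add_zero, Nat.choose_zero_right, Nat.cast_one] at h3
    obtain ⟨d, rfl⟩ := Nat.exists_eq_add_of_le h
    rw [add_comm k d, Function.iterate_add_apply, h3]
    cases d with
    | zero => simp
    | succ d =>
      rw [Function.iterate_succ_apply, fwdDiff_const]
      have : ∀ d : ℕ, (fwdDiff (1 : ℕ))^[d] (fun _ : ℕ => (0 : ℤ)) = fun _ => 0 := by
        intro d
        induction d with
        | zero => rfl
        | succ d ih => rw [Function.iterate_succ_apply, fwdDiff_const, ih]
      rw [this, if_neg (by omega)]
  rw [h2] at h1
  have h4 : ∑ j ∈ Finset.range (n + 1), (-1 : ℤ) ^ j * n.choose j * (j + k).choose k =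
      (-1 : ℤ) ^ n * if k = n then 1 else 0 := by
    rw [h1, Finset.mul_sum]
    refine Finset.sum_congr rfl fun j hj => ?_
    have hj' : j ≤ n := by simpa [Nat.lt_succ_iff] using hj
    obtain ⟨d, rfl⟩ := Nat.exists_eq_add_of_le hj'
    simp only [Nat.add_sub_cancel_left, smul_eq_mul, mul_one]
    rw [show k + j = j + k by ring, pow_add]
    have : ((-1 : ℤ) ^ d) * (-1) ^ d = 1 := by rw [← mul_pow]; simp
    linear_combination -((-1 : ℤ) ^ j * (j + d).choose j * (j + k).choose k) * this
  rw [h4]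
  split_ifs <;> simp

theorem integral_pow_mul_cexp_neg_mul_laguerreFun {n m : ℕ} (h : m ≤ n) :
    ∫ x in Set.Ioi (0 : ℝ), (x : ℂ) ^ m * Complex.exp (-x) * laguerreFun n x =
      if m = n then (-1 : ℂ) ^ n * n.factorial / 2 ^ (n + 1) else 0 := by
  have h1 := integral_pow_mul_cexp_mul_laguerreFun n m (c := 1) (by norm_num)
  simp only [one_mul] at h1
  rw [h1]
  have h2 := congrArg (fun z : ℤ => (z : ℂ)) (alternating_sum_choose_mul_choose h)
  push_cast at h2
  have : ∀ k ∈ Finset.range (n + 1), ((n.choose k : ℂ) * (-2) ^ k / k.factorial) *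
        ((k + m).factorial / (1 + 1) ^ (k + m + 1)) =
      (m.factorial / 2 ^ (m + 1)) * ((-1) ^ k * n.choose k * (k + m).choose m) := by
    intro k _
    have hk : (k.factorial : ℂ) ≠ 0 := by exact_mod_cast k.factorial_ne_zero
    have h3 : ((k + m).factorial : ℂ) = (k + m).choose m * m.factorial * k.factorial := by
      have := Nat.choose_mul_factorial_mul_factorial (Nat.le_add_left m k)
      rw [Nat.add_sub_cancel] at this
      exact_mod_cast this.symm
    rw [h3, show (-2 : ℂ) ^ k = (-1) ^ k * 2 ^ k by rw [← mul_pow]; norm_num]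
    norm_num only
    rw [show k + m + 1 = k + (m + 1) by ring, pow_add]
    field_simp
  rw [Finset.sum_congr rfl this, ← Finset.mul_sum, h2]
  split_ifs with hmn
  · subst hmn; ring
  · simp

theorem integrable_laguerreFun_mul_laguerreFun (n m : ℕ) :
    IntegrableOn (fun x : ℝ => laguerreFun m x * laguerreFun n x) (Set.Ioi 0) := by
  have h : ∀ k, IntegrableOn (fun x : ℝ => (x : ℂ) ^ k * Complex.exp (-x) * laguerreFun n x)
      (Set.Ioi 0) := fun k => by
    have := integrable_pow_mul_cexp_mul_laguerreFun n k (c := 1) (by norm_num)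
    simpa only [one_mul] using this
  simp_rw [laguerreFun_eq_sum m, Finset.sum_mul, mul_assoc _ (_ * _) (laguerreFun n _)]
  exact integrable_finsetSum _ fun k _ => (h k).const_mul _

/-- The Laguerre functions are orthogonal on the half-line, with squared norm `1 / 2`. -/
theorem integral_laguerreFun_mul_laguerreFun (n m : ℕ) :
    ∫ x in Set.Ioi (0 : ℝ), laguerreFun m x * laguerreFun n x = if m = n then (1 / 2 : ℂ) else 0 := by
  wlog h : m ≤ n generalizing n m
  · have := this m n (by omega)
    simp_rw [mul_comm (laguerreFun m _), this, eq_comm]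
  have hi : ∀ k, IntegrableOn (fun x : ℝ => (x : ℂ) ^ k * Complex.exp (-x) * laguerreFun n x)
      (Set.Ioi 0) := fun k => by
    have := integrable_pow_mul_cexp_mul_laguerreFun n k (c := 1) (by norm_num)
    simpa only [one_mul] using this
  simp_rw [laguerreFun_eq_sum m, Finset.sum_mul, mul_assoc _ (_ * _) (laguerreFun n _)]
  rw [integral_finsetSum _ fun k _ => (hi k).const_mul _]
  simp_rw [integral_const_mul]
  -- Only the top-degree term of `φ_m` can pair nontrivially with `φ_n`, since `m ≤ n`.
  rw [Finset.sum_range_succ, integral_pow_mul_cexp_neg_mul_laguerreFun h, Finset.sum_eq_zero]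
  · split_ifs with hmn
    · subst hmn
      have hk : (m.factorial : ℂ) ≠ 0 := by exact_mod_cast m.factorial_ne_zero
      rw [show (-2 : ℂ) ^ m = (-1) ^ m * 2 ^ m by rw [← mul_pow]; norm_num]
      have : ((-1 : ℂ) ^ m) * (-1) ^ m = 1 := by rw [← mul_pow]; simp
      simp only [Nat.choose_self, Nat.cast_one, one_mul, zero_add]
      field_simp
      rw [sq, this]
      ring
    · simp
  · intro k hk
    have : k < m := by simpa using hk
    rw [integral_pow_mul_cexp_neg_mul_laguerreFun (by omega), if_neg (by omega), mul_zero]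

/-! ### Projection error of a single exponential -/

/-- The `n`-th coefficient of `x ↦ exp (-p x)` in the Laguerre functions. -/
noncomputable def laguerreCoeff (n : ℕ) (p : ℂ) : ℂ := 2 * ((p - 1) ^ n / (p + 1) ^ (n + 1))

/-- The residual of `x ↦ exp (-p x)` after projection onto `φ_0, …, φ_N`. -/
noncomputable def expResidual (N : ℕ) (p : ℂ) (x : ℝ) : ℂ :=
  Complex.exp (-(p * x)) - ∑ n ∈ Finset.range (N + 1), laguerreCoeff n p * laguerreFun n x

theorem add_one_ne_zero_of_re_pos {p : ℂ} (hp : 0 < p.re) : p + 1 ≠ 0 := by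
  intro h
  have := congrArg Complex.re h
  simp at this
  linarith

theorem integrable_cexp_neg {c : ℂ} (hc : 0 < c.re) :
    IntegrableOn (fun x : ℝ => Complex.exp (-(c * x))) (Set.Ioi 0) := by
  simpa using integrable_pow_mul_cexp_neg 0 hc

theorem integral_cexp_neg {c : ℂ} (hc : 0 < c.re) :
    ∫ x in Set.Ioi (0 : ℝ), Complex.exp (-(c * x)) = 1 / c := by
  simpa using integral_pow_mul_cexp_neg 0 hc

theorem integrable_cexp_neg_mul_laguerreFun (n : ℕ) {p : ℂ} (hp : 0 < p.re) :
    IntegrableOn (fun x : ℝ => Complex.exp (-(p * x)) * laguerreFun n x) (Set.Ioi 0) := by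
  simpa using integrable_pow_mul_cexp_mul_laguerreFun n 0 (c := p) (by simp; linarith)

theorem integrable_expResidual_mul_laguerreFun (N m : ℕ) {p : ℂ} (hp : 0 < p.re) :
    IntegrableOn (fun x : ℝ => expResidual N p x * laguerreFun m x) (Set.Ioi 0) := by
  simp only [expResidual, sub_mul, Finset.sum_mul, mul_assoc]
  exact (integrable_cexp_neg_mul_laguerreFun m hp).sub (integrable_finsetSum _ fun n _ =>
    (integrable_laguerreFun_mul_laguerreFun m n).const_mul _)

theorem integral_expResidual_mul_laguerreFun {N m : ℕ} (hm : m ≤ N) {p : ℂ} (hp : 0 < p.re) :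
    ∫ x in Set.Ioi (0 : ℝ), expResidual N p x * laguerreFun m x = 0 := by
  simp only [expResidual, sub_mul, Finset.sum_mul, mul_assoc]
  have h (n : ℕ) := (integrable_laguerreFun_mul_laguerreFun m n).const_mul (laguerreCoeff n p)
  rw [integral_sub (integrable_cexp_neg_mul_laguerreFun m hp) (integrable_finsetSum _ fun n _ =>
    h n), integral_finsetSum _ fun n _ => h n]
  simp_rw [integral_const_mul, integral_laguerreFun_mul_laguerreFun]
  rw [Finset.sum_eq_single m (fun n _ hn => by simp [hn])
    (fun hn => by simp at hn; omega), integral_cexp_mul_laguerreFun m hp]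
  simp [laguerreCoeff]
  ring

theorem integrable_expResidual_mul_cexp (N : ℕ) {p q : ℂ} (hp : 0 < p.re) (hq : 0 < q.re) :
    IntegrableOn (fun x : ℝ => expResidual N p x * Complex.exp (-(q * x))) (Set.Ioi 0) := by
  simp only [expResidual, sub_mul, Finset.sum_mul, mul_assoc, ← Complex.exp_add, ← neg_add,
    ← add_mul]
  refine (integrable_cexp_neg (c := p + q) (by simp; linarith)).sub
    (integrable_finsetSum _ fun n _ => Integrable.const_mul ?_ _)
  exact (integrable_cexp_neg_mul_laguerreFun n hq).congr
    (Filter.Eventually.of_forall fun x => mul_comm _ _)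

theorem integral_expResidual_mul_cexp (N : ℕ) {p q : ℂ} (hp : 0 < p.re) (hq : 0 < q.re) :
    ∫ x in Set.Ioi (0 : ℝ), expResidual N p x * Complex.exp (-(q * x)) =
      ((p - 1) / (p + 1) * ((q - 1) / (q + 1))) ^ (N + 1) / (p + q) := by
  have hpq : 0 < (p + q).re := by simp; linarith
  have hi (n : ℕ) : IntegrableOn
      (fun x : ℝ => laguerreCoeff n p * (laguerreFun n x * Complex.exp (-(q * x)))) (Set.Ioi 0) :=
    Integrable.const_mul ((integrable_cexp_neg_mul_laguerreFun n hq).congr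
      (Filter.Eventually.of_forall fun x => mul_comm _ _)) _
  simp only [expResidual, sub_mul, Finset.sum_mul, mul_assoc, ← Complex.exp_add, ← neg_add]
  simp only [← add_mul]
  rw [integral_sub (integrable_cexp_neg hpq) (integrable_finsetSum _ fun n _ => hi n),
    integral_cexp_neg hpq, integral_finsetSum _ fun n _ => hi n]
  simp_rw [integral_const_mul, mul_comm (laguerreFun _ _), integral_cexp_mul_laguerreFun _ hq]
  have hp1 := add_one_ne_zero_of_re_pos hp
  have hq1 := add_one_ne_zero_of_re_pos hq
  have hpq0 : p + q ≠ 0 := by intro h; simp [h] at hpq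
  -- With `z = (p-1)(q-1)/((p+1)(q+1))` one has `1 - z = 2(p+q)/((p+1)(q+1))`, so the geometric sum
  -- telescopes.
  have key (n : ℕ) : laguerreCoeff n p * ((q - 1) ^ n / (q + 1) ^ (n + 1)) =
      ((p - 1) / (p + 1) * ((q - 1) / (q + 1))) ^ n / (p + q) -
      ((p - 1) / (p + 1) * ((q - 1) / (q + 1))) ^ (n + 1) / (p + q) := by
    rw [laguerreCoeff, pow_succ ((p - 1) / (p + 1) * ((q - 1) / (q + 1))), mul_pow, div_pow,
      div_pow, pow_succ (p + 1), pow_succ (q + 1)]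
    field_simp
    ring
  simp_rw [key]
  rw [Finset.sum_range_sub']
  simp

theorem conj_expResidual (N : ℕ) (p : ℂ) (x : ℝ) :
    (starRingEnd ℂ) (expResidual N p x) = Complex.exp (-((starRingEnd ℂ) p * x)) -
      ∑ n ∈ Finset.range (N + 1), (starRingEnd ℂ) (laguerreCoeff n p) * laguerreFun n x := by
  simp [expResidual, conj_laguerreFun, ← Complex.exp_conj]

/-- The residual is orthogonal to `φ_0, …, φ_N`, so its squared norm is its pairing with the
conjugate exponential alone: `integral_expResidual_mul_cexp` at `q = conj p`. -/
theorem lintegral_enorm_expResidual_sq (N : ℕ) {p : ℂ} (hp : 0 < p.re) :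
    ∫⁻ x in Set.Ioi (0 : ℝ), ‖expResidual N p x‖ₑ ^ 2 =
      ENNReal.ofReal ((‖(p - 1) / (p + 1)‖ ^ (N + 1)) ^ 2 / (2 * p.re)) := by
  have hq : 0 < ((starRingEnd ℂ) p).re := by simpa using hp
  have hsq (x : ℝ) : ((‖expResidual N p x‖ ^ 2 : ℝ) : ℂ) =
      expResidual N p x * Complex.exp (-((starRingEnd ℂ) p * x)) -
      ∑ n ∈ Finset.range (N + 1), (starRingEnd ℂ) (laguerreCoeff n p) *
        (expResidual N p x * laguerreFun n x) := by
    rw [Complex.ofReal_pow, ← Complex.mul_conj', conj_expResidual, mul_sub, Finset.mul_sum]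
    congr 1
    exact Finset.sum_congr rfl fun n _ => by ring
  have h1 := integrable_expResidual_mul_cexp N hp hq
  have h2 (n : ℕ) := (integrable_expResidual_mul_laguerreFun N n hp).const_mul
    ((starRingEnd ℂ) (laguerreCoeff n p))
  have hint : IntegrableOn (fun x => ((‖expResidual N p x‖ ^ 2 : ℝ) : ℂ)) (Set.Ioi 0) := by
    simp_rw [hsq]
    exact h1.sub (integrable_finsetSum _ fun n _ => h2 n)
  have hval : ∫ x in Set.Ioi (0 : ℝ), ‖expResidual N p x‖ ^ 2 =
      (‖(p - 1) / (p + 1)‖ ^ (N + 1)) ^ 2 / (2 * p.re) := by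
    have : ((∫ x in Set.Ioi (0 : ℝ), ‖expResidual N p x‖ ^ 2 : ℝ) : ℂ) =
        (((‖(p - 1) / (p + 1)‖ ^ (N + 1)) ^ 2 / (2 * p.re) : ℝ) : ℂ) := by
      rw [← integral_complex_ofReal]
      simp_rw [hsq]
      rw [integral_sub h1 (integrable_finsetSum _ fun n _ => h2 n),
        integral_finsetSum _ fun n _ => h2 n, Finset.sum_eq_zero, sub_zero,
        integral_expResidual_mul_cexp N hp hq]
      · have : ((starRingEnd ℂ) p - 1) / ((starRingEnd ℂ) p + 1) =
            (starRingEnd ℂ) ((p - 1) / (p + 1)) := by simp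
        rw [this, Complex.mul_conj', Complex.add_conj]
        push_cast
        ring
      · intro n hn
        rw [integral_const_mul, integral_expResidual_mul_laguerreFun
          (by simpa [Nat.lt_succ_iff] using hn) hp, mul_zero]
    exact_mod_cast this
  have hint' : IntegrableOn (fun x => ‖expResidual N p x‖ ^ 2) (Set.Ioi 0) := by
    simpa only [IntegrableOn, RCLike.re_to_complex, Complex.ofReal_re] using hint.re
  rw [← hval, ofReal_integral_eq_lintegral_ofReal hint'
    (Filter.Eventually.of_forall fun x => by positivity)]
  refine lintegral_congr fun x => ?_
  rw [ENNReal.ofReal_pow (norm_nonneg _), ofReal_norm]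

/-- The squared modulus is `(1-y)/(1+y)` with `y = 2 Re p/(1+|p|²)`, and `log((1+y)/(1-y)) ≥ 2y`. -/
theorem norm_sub_one_div_add_one_le {p : ℂ} (hp : 0 < p.re) :
    ‖(p - 1) / (p + 1)‖ ≤ Real.exp (-(2 * p.re / (1 + ‖p‖ ^ 2))) := by
  have hm : 0 < 1 + ‖p‖ ^ 2 := by positivity
  have hn : ‖p‖ ^ 2 = p.re ^ 2 + p.im ^ 2 := by
    rw [← Complex.normSq_eq_norm_sq, Complex.normSq_apply]; ring
  set y := 2 * p.re / (1 + ‖p‖ ^ 2) with hy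
  have hy0 : 0 < y := by positivity
  have hy1 : y ≤ 1 := by
    rw [hy, div_le_one hm, hn]; nlinarith [sq_nonneg (p.re - 1), sq_nonneg p.im]
  have hsq : ‖(p - 1) / (p + 1)‖ ^ 2 = (1 - y) / (1 + y) := by
    rw [norm_div, div_pow, ← Complex.normSq_eq_norm_sq, ← Complex.normSq_eq_norm_sq,
      Complex.normSq_apply, Complex.normSq_apply, hy]
    simp only [Complex.sub_re, Complex.one_re, Complex.sub_im, Complex.one_im, sub_zero,
      Complex.add_re, Complex.add_im, add_zero]
    have h1 : (p.re + 1) * (p.re + 1) + p.im * p.im ≠ 0 := by nlinarith [sq_nonneg p.im]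
    have h2 : 1 + 2 * p.re / (1 + ‖p‖ ^ 2) ≠ 0 := by positivity
    rw [div_eq_div_iff h1 h2]
    field_simp
    rw [hn]
    ring
  rw [← abs_of_nonneg (norm_nonneg ((p - 1) / (p + 1))), ← abs_of_pos (Real.exp_pos (-y)),
    ← sq_le_sq, hsq]
  rcases hy1.eq_or_lt with h1 | h1
  -- The case `y = 1`, where the logarithm is unavailable, is `p = 1`.
  · rw [h1]; simp; positivity
  have h := Real.sum_range_le_log_div hy0.le h1 1
  simp only [Finset.range_one, Finset.sum_singleton, mul_zero, zero_add, pow_one, Nat.cast_zero,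
    div_one] at h
  have h3 : (1 - y) / (1 + y) = Real.exp (-Real.log ((1 + y) / (1 - y))) := by
    rw [Real.exp_neg, Real.exp_log (div_pos (by linarith) (by linarith)), inv_div]
  rw [h3, sq, ← Real.exp_add]
  exact Real.exp_le_exp.2 (by linarith)

theorem norm_sub_one_div_add_one_le_one {p : ℂ} (hp : 0 < p.re) : ‖(p - 1) / (p + 1)‖ ≤ 1 :=
  (norm_sub_one_div_add_one_le hp).trans (Real.exp_le_one_iff.2 (by
    have : 0 < 2 * p.re / (1 + ‖p‖ ^ 2) := by positivity
    linarith))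

theorem norm_laguerreCoeff_le (n : ℕ) {p : ℂ} (hp : 0 < p.re) : ‖laguerreCoeff n p‖ ≤ 2 := by
  have h1 : 1 ≤ ‖p + 1‖ := by
    have := Complex.re_le_norm (p + 1)
    simp at this
    linarith
  have : laguerreCoeff n p = 2 * (((p - 1) / (p + 1)) ^ n / (p + 1)) := by
    rw [laguerreCoeff, div_pow, div_div, pow_succ]
  rw [this, norm_mul, norm_div, norm_pow, Complex.norm_ofNat]
  have h2 := pow_le_one₀ (n := n) (norm_nonneg _) (norm_sub_one_div_add_one_le_one hp)
  have h3 : ‖(p - 1) / (p + 1)‖ ^ n / ‖p + 1‖ ≤ 1 := (div_le_one (by linarith)).2 (h2.trans h1)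
  linarith

/-! ### Superpositions of exponentials -/

/-- Minkowski's integral inequality in L², with a majorant `A` of the norms. Cauchy–Schwarz for `g =
A^(1/2) · (A^(-1/2) g)`, then Tonelli; `A` must be nonzero and finite to cancel against its inverse.
-/
theorem lintegral_sq_lintegral_le {α β : Type*} [MeasurableSpace α] [MeasurableSpace β]
    (μ : Measure α) (ν : Measure β) [SFinite μ] [SFinite ν] {g : α → β → ℝ≥0∞}
    (hg : Measurable (Function.uncurry g)) {A : α → ℝ≥0∞} (hA : Measurable A)
    (h0 : ∀ᵐ t ∂μ, A t ≠ 0) (htop : ∀ᵐ t ∂μ, A t ≠ ∞)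
    (h : ∀ᵐ t ∂μ, ∫⁻ x, g t x ^ 2 ∂ν ≤ A t ^ 2) :
    ∫⁻ x, (∫⁻ t, g t x ∂μ) ^ 2 ∂ν ≤ (∫⁻ t, A t ∂μ) ^ 2 := by
  have hgx (x : β) : Measurable fun t => g t x := hg.comp (measurable_id.prodMk measurable_const)
  have step (x : β) :
      (∫⁻ t, g t x ∂μ) ^ 2 ≤ (∫⁻ t, A t ∂μ) * ∫⁻ t, (A t)⁻¹ * g t x ^ 2 ∂μ := by
    have hH := ENNReal.lintegral_mul_le_Lp_mul_Lq μ Real.HolderConjugate.two_two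
      (f := fun t => A t ^ (1 / 2 : ℝ)) (g := fun t => (A t)⁻¹ ^ (1 / 2 : ℝ) * g t x)
      (hA.pow_const _).aemeasurable ((hA.inv.pow_const _).mul (hgx x)).aemeasurable
    have e1 : ∫⁻ t, g t x ∂μ = ∫⁻ t, ((fun t => A t ^ (1 / 2 : ℝ)) *
        fun t => (A t)⁻¹ ^ (1 / 2 : ℝ) * g t x) t ∂μ := by
      refine lintegral_congr_ae ?_
      filter_upwards [h0, htop] with t h1 h2
      simp only [Pi.mul_apply]
      rw [← mul_assoc, ← ENNReal.mul_rpow_of_nonneg _ _ (by norm_num),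
        ENNReal.mul_inv_cancel h1 h2, ENNReal.one_rpow, one_mul]
    rw [e1]
    refine (pow_le_pow_left' hH 2).trans (le_of_eq ?_)
    have half (a : ℝ≥0∞) : (a ^ (1 / 2 : ℝ)) ^ 2 = a := by
      rw [← ENNReal.rpow_natCast, ← ENNReal.rpow_mul]; norm_num
    rw [mul_pow, half, half]
    simp only [ENNReal.rpow_two, mul_pow, half]
  have hmeas : Measurable (Function.uncurry fun (x : β) (t : α) => (A t)⁻¹ * g t x ^ 2) :=
    (hA.inv.comp measurable_snd).mul ((hg.comp measurable_swap).pow_const 2)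
  calc ∫⁻ x, (∫⁻ t, g t x ∂μ) ^ 2 ∂ν
      ≤ ∫⁻ x, (∫⁻ t, A t ∂μ) * ∫⁻ t, (A t)⁻¹ * g t x ^ 2 ∂μ ∂ν := lintegral_mono step
    _ = (∫⁻ t, A t ∂μ) * ∫⁻ t, ∫⁻ x, (A t)⁻¹ * g t x ^ 2 ∂ν ∂μ := by
        rw [lintegral_const_mul _ (show Measurable fun x => ∫⁻ t, (A t)⁻¹ * g t x ^ 2 ∂μ from
            hmeas.lintegral_prod_right'),
          lintegral_lintegral_swap hmeas.aemeasurable]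
    _ ≤ (∫⁻ t, A t ∂μ) * ∫⁻ t, A t ∂μ := by
        refine mul_le_mul' le_rfl (lintegral_mono_ae ?_)
        filter_upwards [h0, htop, h] with t h1 h2 h3
        rw [lintegral_const_mul _ (show Measurable fun x => g t x ^ 2 from
          (hg.comp measurable_prodMk_left).pow_const 2)]
        calc (A t)⁻¹ * ∫⁻ x, g t x ^ 2 ∂ν ≤ (A t)⁻¹ * A t ^ 2 := by gcongr
          _ = A t := by rw [sq, ← mul_assoc, ENNReal.inv_mul_cancel h1 h2, one_mul]
    _ = _ := (sq _).symm

theorem measurable_laguerreCoeff (n : ℕ) : Measurable (laguerreCoeff n) := by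
  unfold laguerreCoeff
  fun_prop

theorem measurable_expResidual (N : ℕ) : Measurable (Function.uncurry (expResidual N)) := by
  have h1 (n : ℕ) : Measurable fun a : ℂ × ℝ => laguerreCoeff n a.1 :=
    (measurable_laguerreCoeff n).comp measurable_fst
  have h2 (n : ℕ) : Measurable fun a : ℂ × ℝ => laguerreFun n a.2 :=
    (continuous_laguerreFun n).measurable.comp measurable_snd
  refine Measurable.sub (f := fun a : ℂ × ℝ => Complex.exp (-(a.1 * a.2))) (by fun_prop) ?_
  exact Finset.measurable_fun_sum _ fun n _ => (h1 n).mul (h2 n)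

theorem exists_radialSpace_eLpNorm_le (N : ℕ) (μ : Measure ℝ) [SFinite μ] {p w : ℝ → ℂ}
    (hp : Measurable p) (hw : Measurable w) (hwi : Integrable w μ) (hre : ∀ᵐ t ∂μ, 0 < (p t).re)
    {A : ℝ → ℝ} (hA : Measurable A) (hA0 : ∀ᵐ t ∂μ, 0 < A t)
    (hle : ∀ᵐ t ∂μ,
      ‖w t‖ * (‖(p t - 1) / (p t + 1)‖ ^ (N + 1) / √(2 * (p t).re)) ≤ A t) :
    ∃ u ∈ radialSpace N, eLpNorm (fun x : ℝ => (∫ t, w t * Complex.exp (-(p t * x)) ∂μ) - u x) 2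
      (volume.restrict (Set.Ici (0 : ℝ))) ≤ ∫⁻ t, ENNReal.ofReal (A t) ∂μ := by
  -- The approximant is the superposition of the projections, so the error is the superposition of
  -- the residuals.
  refine ⟨∑ n ∈ Finset.range (N + 1), (∫ t, w t * laguerreCoeff n (p t) ∂μ) • laguerreFun n,
    Submodule.sum_mem _ fun n hn => Submodule.smul_mem _ _ (Submodule.subset_span
      ⟨n, by simpa [Nat.lt_succ_iff] using hn, rfl⟩), ?_⟩
  rw [restrict_Ioi_eq_restrict_Ici.symm]
  have hci (n : ℕ) : Integrable (fun t => w t * laguerreCoeff n (p t)) μ :=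
    hwi.mul_bdd (c := 2) ((measurable_laguerreCoeff n).comp hp).aestronglyMeasurable
      (hre.mono fun t ht => norm_laguerreCoeff_le n ht)
  have hei (x : ℝ) (hx : 0 ≤ x) : Integrable (fun t => w t * Complex.exp (-(p t * x))) μ :=
    hwi.mul_bdd (c := 1) (by fun_prop) (hre.mono fun t ht => by
      rw [Complex.norm_exp]
      simp only [Complex.neg_re, Complex.mul_re, Complex.ofReal_re, Complex.ofReal_im, mul_zero,
        sub_zero, Real.exp_le_one_iff]
      have := mul_nonneg ht.le hx
      linarith)
  have hf : ∀ x ∈ Set.Ioi (0 : ℝ), (∫ t, w t * Complex.exp (-(p t * x)) ∂μ) -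
      (∑ n ∈ Finset.range (N + 1), (∫ t, w t * laguerreCoeff n (p t) ∂μ) • laguerreFun n) x =
      ∫ t, w t * expResidual N (p t) x ∂μ := by
    intro x hx
    have hx' : 0 ≤ x := le_of_lt hx
    simp only [expResidual, mul_sub, Finset.mul_sum, Finset.sum_apply, Pi.smul_apply, smul_eq_mul,
      ← mul_assoc]
    rw [integral_sub (hei x hx') (integrable_finsetSum _ fun n _ => (hci n).mul_const _),
      integral_finsetSum _ fun n _ => (hci n).mul_const _]
    simp_rw [integral_mul_const]
  rw [eLpNorm_eq_lintegral_rpow_enorm_toReal (by simp) (by simp)]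
  simp only [ENNReal.toReal_ofNat, ENNReal.rpow_two]
  have hmeas : Measurable (Function.uncurry fun (t x : ℝ) => ‖w t * expResidual N (p t) x‖ₑ) :=
    ((hw.comp measurable_fst).mul ((measurable_expResidual N).comp
      ((hp.comp measurable_fst).prodMk measurable_snd))).enorm
  have hmink := lintegral_sq_lintegral_le μ (volume.restrict (Set.Ioi (0 : ℝ))) hmeas
    (A := fun t => ENNReal.ofReal (A t)) hA.ennreal_ofReal
    (hA0.mono fun t ht => by simpa using ht) (Filter.Eventually.of_forall fun t => by simp) (by
      filter_upwards [hre, hle, hA0] with t h1 h2 h3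
      simp_rw [enorm_mul, mul_pow]
      rw [lintegral_const_mul _ (show Measurable fun x => ‖expResidual N (p t) x‖ₑ ^ 2 from
          ((measurable_expResidual N).comp measurable_prodMk_left).enorm.pow_const 2),
        lintegral_enorm_expResidual_sq N h1, ← ofReal_norm,
        ← ENNReal.ofReal_pow (norm_nonneg _), ← ENNReal.ofReal_mul (by positivity),
        ← ENNReal.ofReal_pow h3.le]
      refine ENNReal.ofReal_le_ofReal ?_
      refine le_trans (le_of_eq ?_) (pow_le_pow_left₀ (by positivity) h2 2)
      rw [mul_pow, div_pow (_ ^ (N + 1)), Real.sq_sqrt (by linarith)])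
  have h1 : ∫⁻ x in Set.Ioi (0 : ℝ), ‖(∫ t, w t * Complex.exp (-(p t * x)) ∂μ) -
      (∑ n ∈ Finset.range (N + 1), (∫ t, w t * laguerreCoeff n (p t) ∂μ) • laguerreFun n) x‖ₑ ^ 2 ≤
      (∫⁻ t, ENNReal.ofReal (A t) ∂μ) ^ 2 := by
    refine le_trans (setLIntegral_mono' measurableSet_Ioi fun x hx => ?_) hmink
    rw [hf x hx]
    exact pow_le_pow_left' (enorm_integral_le_lintegral_enorm _) 2
  calc _ ≤ ((∫⁻ t, ENNReal.ofReal (A t) ∂μ) ^ 2) ^ (1 / 2 : ℝ) := by gcongr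
    _ = _ := by rw [← ENNReal.rpow_natCast, ← ENNReal.rpow_mul]; norm_num

/-! ### The segment contribution -/

theorem exp_neg_mul_le_exp_neg_mul_sqrt {κ : ℝ} (hκ : 0 < κ) (b : ℝ) {n : ℝ} (hn : 0 ≤ n) :
    Real.exp (-(κ * n)) ≤ Real.exp (b ^ 2 / (4 * κ)) * Real.exp (-(b * √n)) := by
  rw [← Real.exp_add, Real.exp_le_exp]
  have h : b ^ 2 / (4 * κ) + -(b * √n) + κ * n = (2 * κ * √n - b) ^ 2 / (4 * κ) := by
    nth_rewrite 2 [← Real.sq_sqrt hn]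
    field_simp
    ring
  have : 0 ≤ (2 * κ * √n - b) ^ 2 / (4 * κ) := by positivity
  linarith

theorem integral_segment_cexp (s q : ℂ) {y : ℂ} (hy : y ≠ 0) :
    ∫ t in Set.Ioc (0 : ℝ) 1, (q - s) * Complex.exp (-((s + t * (q - s)) * y)) =
      (Complex.exp (-(s * y)) - Complex.exp (-(q * y))) / y := by
  rw [← intervalIntegral.integral_of_le zero_le_one]
  have hd (t : ℝ) : HasDerivAt
      (fun t : ℝ => -(Complex.exp (-((s + t * (q - s)) * y)) / y))
      ((q - s) * Complex.exp (-((s + t * (q - s)) * y))) t := by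
    have h := ((((((hasDerivAt_id t).ofReal_comp.mul_const (q - s)).const_add s).mul_const
      y).neg.cexp).div_const y).neg
    refine h.congr_deriv ?_
    simp only [id, Pi.neg_apply, Complex.ofReal_one, one_mul]
    field_simp
  rw [intervalIntegral.integral_eq_sub_of_hasDerivAt (fun t _ => hd t)
    (Continuous.intervalIntegrable (by fun_prop) _ _)]
  simp
  ring

/-- On the segment `Re p` is bounded below and `|p|` above, which makes the decay exponential in
`N`. It therefore beats `exp(-b√(N+1))` for any `b`, left free to match the ray. -/
theorem exists_radialSpace_segment_le {s q : ℂ} (hs : 0 < s.re) (hq : 0 < q.re) (D : ℂ) {r : ℂ}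
    (hr : ∀ x : ℝ, 0 ≤ x → r + x ≠ 0) (b : ℝ) :
    ∃ C : ℝ, 0 < C ∧ ∀ N : ℕ, ∃ u ∈ radialSpace N,
      eLpNorm (fun x : ℝ => D * ((Complex.exp (-(s * (r + x))) - Complex.exp (-(q * (r + x)))) /
        (r + x)) - u x) 2 (volume.restrict (Set.Ici (0 : ℝ))) ≤
      ENNReal.ofReal (C * Real.exp (-(b * √(N + 1)))) := by
  set m := min s.re q.re
  have hm : 0 < m := lt_min hs hq
  set M := ‖s‖ + ‖q‖
  set κ := 2 * m / (1 + M ^ 2)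
  have hκ : 0 < κ := by positivity
  -- The `+ 1` keeps the majorant positive even if `D = 0` or `q = s`.
  set W := ‖D‖ * ‖q - s‖ * Real.exp (M * ‖r‖) + 1
  have hW : 0 < W := by positivity
  set p : ℝ → ℂ := fun t => s + t * (q - s)
  have hpc : Continuous p := by fun_prop
  have hre : ∀ t ∈ Set.Ioc (0 : ℝ) 1, m ≤ (p t).re := by
    intro t ht
    have h1 : m ≤ s.re := min_le_left _ _
    have h2 : m ≤ q.re := min_le_right _ _
    simp only [p, Complex.add_re, Complex.mul_re, Complex.ofReal_re, Complex.ofReal_im, zero_mul,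
      sub_zero, Complex.sub_re]
    nlinarith [mul_nonneg ht.1.le (sub_nonneg.2 h2), mul_nonneg (sub_nonneg.2 ht.2)
      (sub_nonneg.2 h1)]
  have hnorm : ∀ t ∈ Set.Ioc (0 : ℝ) 1, ‖p t‖ ≤ M := by
    intro t ht
    have : p t = ((1 - t : ℝ) : ℂ) * s + t * q := by simp only [p]; push_cast; ring
    rw [this]
    refine (norm_add_le _ _).trans ?_
    rw [norm_mul, norm_mul, Complex.norm_real, Complex.norm_real,
      Real.norm_of_nonneg (by linarith [ht.2]), Real.norm_of_nonneg ht.1.le]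
    exact add_le_add (mul_le_of_le_one_left (norm_nonneg _) (by linarith [ht.1]))
      (mul_le_of_le_one_left (norm_nonneg _) ht.2)
  set w : ℝ → ℂ := fun t => D * ((q - s) * Complex.exp (-(p t * r)))
  have hwc : Continuous w := by fun_prop
  refine ⟨W / √(2 * m) * Real.exp (b ^ 2 / (4 * κ)), by positivity, fun N => ?_⟩
  obtain ⟨u, hu, hle⟩ := exists_radialSpace_eLpNorm_le N (volume.restrict (Set.Ioc (0 : ℝ) 1))
    hpc.measurable hwc.measurable
    (hwc.integrableOn_Ioc)
    ((ae_restrict_mem measurableSet_Ioc).mono fun t ht => hm.trans_le (hre t ht))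
    (A := fun _ => W / √(2 * m) * Real.exp (-(κ * (N + 1)))) measurable_const
    (Filter.Eventually.of_forall fun t => by positivity)
    ((ae_restrict_mem measurableSet_Ioc).mono fun t ht => by
      have hp := hm.trans_le (hre t ht)
      have h1 : ‖w t‖ ≤ W := by
        simp only [w, norm_mul]
        rw [← mul_assoc]
        have : ‖Complex.exp (-(p t * r))‖ ≤ Real.exp (M * ‖r‖) := by
          refine (Complex.norm_exp_le_exp_norm _).trans (Real.exp_le_exp.2 ?_)
          rw [norm_neg, norm_mul]
          exact mul_le_mul_of_nonneg_right (hnorm t ht) (norm_nonneg _)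
        have := mul_le_mul_of_nonneg_left this (by positivity : 0 ≤ ‖D‖ * ‖q - s‖)
        linarith
      have h2 : ‖(p t - 1) / (p t + 1)‖ ≤ Real.exp (-κ) := by
        refine (norm_sub_one_div_add_one_le hp).trans (Real.exp_le_exp.2 (neg_le_neg ?_))
        have := hre t ht
        have := hnorm t ht
        simp only [κ]
        gcongr
      have h3 : ‖(p t - 1) / (p t + 1)‖ ^ (N + 1) ≤ Real.exp (-(κ * (N + 1))) := by
        refine (pow_le_pow_left₀ (norm_nonneg _) h2 _).trans (le_of_eq ?_)
        rw [← Real.exp_nat_mul]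
        push_cast
        ring_nf
      have h4 : √(2 * m) ≤ √(2 * (p t).re) := Real.sqrt_le_sqrt (by linarith [hre t ht])
      calc _ ≤ W * (Real.exp (-(κ * (N + 1))) / √(2 * m)) := by gcongr
        _ = _ := by ring)
  refine ⟨u, hu, (eLpNorm_congr_ae ?_).trans_le (hle.trans ?_)⟩
  · filter_upwards [ae_restrict_mem measurableSet_Ici] with x hx
    rw [← integral_segment_cexp s q (hr x hx), ← integral_const_mul]
    congr 1
    refine integral_congr_ae (Filter.Eventually.of_forall fun t => ?_)
    simp only [w, p, mul_assoc]
    rw [← Complex.exp_add]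
    ring_nf
  · rw [lintegral_const]
    simp only [Measure.restrict_apply MeasurableSet.univ, Set.univ_inter, Real.volume_Ioc,
      sub_zero, ENNReal.ofReal_one, mul_one]
    refine ENNReal.ofReal_le_ofReal ?_
    rw [mul_assoc]
    gcongr
    exact exp_neg_mul_le_exp_neg_mul_sqrt hκ b (by positivity)

/-! ### The ray contribution -/

theorem integral_Ioi_one_mul_cexp_neg_sq {c : ℂ} (hc : 0 < c.re) :
    ∫ t in Set.Ioi (1 : ℝ), 2 * ((t : ℂ) * Complex.exp (-c * t ^ 2)) = Complex.exp (-c) / c := by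
  have hc0 : c ≠ 0 := by rintro rfl; simp at hc
  have hd (t : ℝ) : HasDerivAt (fun t : ℝ => -(Complex.exp (-c * (t : ℂ) ^ 2) / c))
      (2 * ((t : ℂ) * Complex.exp (-c * t ^ 2))) t := by
    have h := ((((hasDerivAt_id t).ofReal_comp.pow 2).const_mul (-c)).cexp.div_const c).neg
    refine h.congr_deriv ?_
    simp only [id, Pi.pow_apply]
    field_simp
    simp
    ring
  have ht : Filter.Tendsto (fun t : ℝ => -(Complex.exp (-c * (t : ℂ) ^ 2) / c)) Filter.atTop
      (nhds 0) := by
    have h := ((tendsto_pow_mul_cexp_neg 0 hc).comp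
      (Filter.tendsto_pow_atTop (α := ℝ) two_ne_zero)).div_const c
    simpa [Function.comp_def] using h.neg
  rw [integral_Ioi_of_hasDerivAt_of_tendsto' (fun t _ => hd t)
    ((integrable_mul_cexp_neg_mul_sq hc).const_mul 2).integrableOn ht]
  simp

/-- A quantitative form of `v + m²/v ≥ 2m` at `v = t² + ρ/t²`: the excess is at least `(√v - √m)²`.
Replacing `√v` by `t` and `v` by `t²` costs only a constant since `t ≥ 1`. The quadratic gain makes
the integral over `t` bounded uniformly in `m`. -/
theorem sq_add_div_ge {t ρ m : ℝ} (ht : 1 ≤ t) (hρ : 0 ≤ ρ) (hm : 0 ≤ m) :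
    2 * m + (t - √m) ^ 2 / 2 - (ρ + ρ ^ 2 / 4) ≤ t ^ 2 + m ^ 2 * t ^ 2 / (ρ + t ^ 4) := by
  have ht0 : 0 < t := by linarith
  set v := t ^ 2 + ρ / t ^ 2 with hv
  have hρt : ρ / t ^ 2 ≤ ρ := div_le_self hρ (by nlinarith)
  have hρ0 : 0 ≤ ρ / t ^ 2 := by positivity
  have hv0 : 0 < v := by positivity
  have e1 : m ^ 2 * t ^ 2 / (ρ + t ^ 4) = m ^ 2 / v := by
    rw [hv]; field_simp; ring
  set g := √v with hg
  set μ := √m with hμ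
  have hg0 : 0 < g := Real.sqrt_pos.2 hv0
  have hgv : g ^ 2 = v := Real.sq_sqrt hv0.le
  have hμm : μ ^ 2 = m := Real.sq_sqrt hm
  have hμ0 : 0 ≤ μ := Real.sqrt_nonneg m
  have hgt : t ≤ g := Real.le_sqrt_of_sq_le (by linarith)
  have hgt2 : g - t ≤ ρ / 2 := by nlinarith
  have e2 : v + m ^ 2 / v - 2 * m = (g - μ) ^ 2 * ((g + μ) / g) ^ 2 := by
    rw [← hgv, ← hμm]; field_simp; ring
  have e3 : (g - μ) ^ 2 ≤ (g - μ) ^ 2 * ((g + μ) / g) ^ 2 := by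
    refine le_mul_of_one_le_right (sq_nonneg _) (one_le_pow₀ ?_)
    rw [le_div_iff₀ hg0]; linarith
  have e4 : (g - t) ^ 2 ≤ ρ ^ 2 / 4 := by nlinarith
  have e5 : (t - μ) ^ 2 / 2 ≤ (g - μ) ^ 2 + (g - t) ^ 2 := by
    nlinarith [sq_nonneg ((g - μ) + (g - t))]
  rw [e1]
  linarith

theorem lintegral_ofReal_mul_exp_neg_sq {K a : ℝ} (hK : 0 ≤ K) (ha : 0 < a) (μ : ℝ) :
    ∫⁻ t : ℝ, ENNReal.ofReal (K * Real.exp (-a * (t - μ) ^ 2)) =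
      ENNReal.ofReal (K * √(Real.pi / a)) := by
  rw [← ofReal_integral_eq_lintegral_ofReal
    (((integrable_exp_neg_mul_sq ha).comp_sub_right μ).const_mul K)
    (Filter.Eventually.of_forall fun t => by positivity), integral_const_mul,
    integral_sub_right_eq_self (fun t => Real.exp (-a * t ^ 2)) μ, integral_gaussian]

theorem exists_radialSpace_ray_le {β : ℂ} (hβ : 0 < β.re) (D : ℂ) :
    ∃ C : ℝ, 0 < C ∧ ∀ N : ℕ, ∃ u ∈ radialSpace N,
      eLpNorm (fun x : ℝ => D * (Complex.exp (-(β⁻¹ * (β ^ 2 + x))) / (β ^ 2 + x)) - u x) 2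
        (volume.restrict (Set.Ici (0 : ℝ))) ≤
      ENNReal.ofReal (C * Real.exp (-(2 * β.re * √(2 * (N + 1))))) := by
  have hβ0 : β ≠ 0 := by rintro rfl; simp at hβ
  have hβn : 0 < ‖β‖ := norm_pos_iff.2 hβ0
  set a := β.re with ha
  set ρ := ‖β‖ ^ 2 with hρ
  have hρ0 : 0 < ρ := by positivity
  have hinv : (β⁻¹).re = a / ρ := by
    rw [Complex.inv_re, Complex.normSq_eq_norm_sq]
  set p : ℝ → ℂ := fun t => ((t ^ 2 : ℝ) : ℂ) * β⁻¹
  have hpc : Continuous p := by fun_prop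
  have hpre (t : ℝ) : (p t).re = t ^ 2 * (a / ρ) := by
    simp only [p, Complex.re_ofReal_mul, hinv]
  -- `D exp(-p r) dp/dt`, with `r = β²` and hence `p r = β t²`.
  set w : ℝ → ℂ := fun t => D * (β⁻¹ * (2 * ((t : ℂ) * Complex.exp (-β * t ^ 2))))
  have hwc : Continuous w := by fun_prop
  have hwi : IntegrableOn w (Set.Ioi 1) :=
    ((((integrable_mul_cexp_neg_mul_sq hβ).const_mul 2).const_mul β⁻¹).const_mul D).integrableOn
  have hwn (t : ℝ) (ht : 0 < t) : ‖w t‖ = ‖D‖ * (‖β‖⁻¹ * (2 * (t * Real.exp (-(a * t ^ 2))))) := by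
    simp only [w, norm_mul, norm_inv, Complex.norm_ofNat, Complex.norm_real,
      Real.norm_of_nonneg ht.le, Complex.norm_exp]
    have : (-β * (t : ℂ) ^ 2).re = -(a * t ^ 2) := by
      rw [← Complex.ofReal_pow, Complex.re_mul_ofReal, Complex.neg_re]; ring
    rw [this]
  set K := (‖D‖ + 1) * (2 / √(2 * a)) * Real.exp (a * (ρ + ρ ^ 2 / 4))
  have hK : 0 < K := by positivity
  refine ⟨K * √(Real.pi / (a / 2)), by positivity, fun N => ?_⟩
  set m := √(2 * ((N : ℝ) + 1)) with hm
  have hm2 : m ^ 2 = 2 * ((N : ℝ) + 1) := Real.sq_sqrt (by positivity)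
  have hm0 : 0 ≤ m := Real.sqrt_nonneg _
  obtain ⟨u, hu, hle⟩ := exists_radialSpace_eLpNorm_le N (volume.restrict (Set.Ioi (1 : ℝ)))
    hpc.measurable hwc.measurable hwi
    ((ae_restrict_mem measurableSet_Ioi).mono fun t ht => by
      have : (0 : ℝ) < t := zero_lt_one.trans ht
      rw [hpre]; positivity)
    (A := fun t => K * Real.exp (-(2 * a * m)) * Real.exp (-(a / 2) * (t - √m) ^ 2))
    (by fun_prop) (Filter.Eventually.of_forall fun t => by positivity)
    ((ae_restrict_mem measurableSet_Ioi).mono fun t (ht : 1 < t) => by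
      have ht0 : 0 < t := zero_lt_one.trans ht
      have hp : 0 < (p t).re := by rw [hpre]; positivity
      have hpn : ‖p t‖ ^ 2 = t ^ 4 / ρ := by
        simp only [p, norm_mul, Complex.norm_real, norm_inv, Real.norm_of_nonneg (sq_nonneg t)]
        rw [mul_pow, hρ]; field_simp
      have h1 : ‖(p t - 1) / (p t + 1)‖ ^ (N + 1) ≤
          Real.exp (-(a * (m ^ 2 * t ^ 2 / (ρ + t ^ 4)))) := by
        refine (pow_le_pow_left₀ (norm_nonneg _) (norm_sub_one_div_add_one_le hp) _).trans
          (le_of_eq ?_)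
        rw [← Real.exp_nat_mul, hpre, hpn, hm2]
        congr 1
        push_cast
        field_simp
      -- This factor `t` cancels the Jacobian's, so only exponentials remain and no power of `N` is
      -- lost.
      have h2 : √(2 * (p t).re) = √(2 * a) * t / ‖β‖ := by
        rw [hpre, show 2 * (t ^ 2 * (a / ρ)) = 2 * a * (t / ‖β‖) ^ 2 by rw [hρ]; field_simp,
          Real.sqrt_mul (by positivity), Real.sqrt_sq (by positivity)]
        ring
      have h3 := mul_le_mul_of_nonneg_left (sq_add_div_ge ht.le hρ0.le hm0) hβ.le
      have hsq : 0 < √(2 * a) := Real.sqrt_pos.2 (by positivity)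
      calc _ ≤ ‖w t‖ * (Real.exp (-(a * (m ^ 2 * t ^ 2 / (ρ + t ^ 4)))) / √(2 * (p t).re)) := by
            gcongr
        _ = ‖D‖ * (2 / √(2 * a)) *
            Real.exp (-(a * (t ^ 2 + m ^ 2 * t ^ 2 / (ρ + t ^ 4)))) := by
            rw [hwn t ht0, h2, mul_add, neg_add, Real.exp_add]
            field_simp
        _ ≤ (‖D‖ + 1) * (2 / √(2 * a)) * Real.exp (a * (ρ + ρ ^ 2 / 4) + -(2 * a * m) +
            -(a / 2) * (t - √m) ^ 2) := by
            gcongr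
            · linarith
            · linarith
        _ = _ := by
            simp only [K]
            rw [Real.exp_add, Real.exp_add]
            ring)
  refine ⟨u, hu, (eLpNorm_congr_ae ?_).trans_le (hle.trans ?_)⟩
  · filter_upwards [ae_restrict_mem measurableSet_Ici] with x hx
    have hx0 : (0 : ℝ) ≤ x := hx
    have hc : 0 < (β + x * β⁻¹).re := by
      rw [Complex.add_re, Complex.re_ofReal_mul, hinv]
      positivity
    have hc0 : β + x * β⁻¹ ≠ 0 := by intro h; simp [h] at hc
    have hy : β ^ 2 + x = β * (β + x * β⁻¹) := by field_simp
    congr 1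
    have e : ∀ t : ℝ, w t * Complex.exp (-(p t * x)) = D * (β⁻¹ *
        (2 * ((t : ℂ) * Complex.exp (-(β + x * β⁻¹) * t ^ 2)))) := fun t => by
      simp only [w, p, mul_assoc]
      rw [← Complex.exp_add]
      push_cast
      ring_nf
    rw [integral_congr_ae (Filter.Eventually.of_forall e), integral_const_mul, integral_const_mul,
      integral_Ioi_one_mul_cexp_neg_sq hc, hy, inv_mul_cancel_left₀ hβ0]
    field_simp
  · refine (lintegral_mono' Measure.restrict_le_self le_rfl).trans ?_
    rw [lintegral_ofReal_mul_exp_neg_sq (by positivity) (by positivity)]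
    refine ENNReal.ofReal_le_ofReal (le_of_eq ?_)
    ring

/-! ### Principal square roots and the final estimate -/

theorem aestronglyMeasurable_of_mem_radialSpace {N : ℕ} {u : ℝ → ℂ} (hu : u ∈ radialSpace N)
    (μ : Measure ℝ) : AEStronglyMeasurable u μ := by
  have : Continuous u := by
    refine Submodule.span_induction ?_ continuous_const (fun f g _ _ hf hg => hf.add hg)
      (fun c f _ hf => hf.const_smul c) hu
    rintro f ⟨n, -, rfl⟩
    exact continuous_laguerreFun n
  exact this.aestronglyMeasurable

theorem Complex.sqrt_ofReal_mul {x : ℝ} (hx : 0 < x) {z : ℂ} (hz : z ≠ 0) :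
    Complex.sqrt ((x : ℂ) * z) = (√x : ℝ) * Complex.sqrt z := by
  have hx0 : (x : ℂ) ≠ 0 := Complex.ofReal_ne_zero.2 hx.ne'
  rw [Complex.sqrt, Complex.sqrt, Complex.cpow_def_of_ne_zero (mul_ne_zero hx0 hz),
    Complex.log_ofReal_mul hx hz, add_mul, Complex.exp_add, ← Complex.cpow_def_of_ne_zero hz,
    Real.sqrt_eq_rpow, Complex.ofReal_cpow hx.le, Complex.cpow_def_of_ne_zero hx0,
    Complex.ofReal_log hx.le]
  norm_num

theorem Complex.sqrt_re_pos {z : ℂ} (hz : z ∈ Complex.slitPlane) : 0 < (Complex.sqrt z).re := by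
  rw [Complex.sqrt, Complex.cpow_inv_two_re, Real.sqrt_pos]
  have h1 := Complex.abs_re_le_norm z
  have h2 := neg_abs_le z.re
  rcases Complex.mem_slitPlane_iff.1 hz with h | h
  · have := norm_nonneg z
    linarith
  · have := Complex.abs_re_lt_norm.2 h
    linarith

theorem mainTheorem1 (R : ℝ) (hR : 0 < R) (ω σ : ℂ) (hσω : 0 < (σ * ω).im)
    (hσ : σ ∈ Complex.slitPlane) :
    ∃ c₁ c₂ : ℝ, 0 < c₁ ∧ 0 < c₂ ∧ ∀ N : ℕ,
      bestApproxError N (fun x : ℝ => sphericalHankel 0 (ω * ((R : ℂ) + σ * (x : ℂ)))) ≤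
        ENNReal.ofReal
          (c₁ * ‖(1 + Complex.I * σ * ω) / (1 - Complex.I * σ * ω)‖ ^ (N + 1)
            + c₂ * Real.exp (-2 *
                (Complex.sqrt (2 * (R : ℂ) * ((N : ℂ) + 1) / σ)).re)) := by
  have hσ0 : σ ≠ 0 := Complex.slitPlane_ne_zero hσ
  have hω0 : ω ≠ 0 := by rintro rfl; simp at hσω
  have hR0 : (R : ℂ) ≠ 0 := Complex.ofReal_ne_zero.2 hR.ne'
  set r : ℂ := R * σ⁻¹ with hr
  have hr0 : r ≠ 0 := mul_ne_zero hR0 (inv_ne_zero hσ0)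
  have hrs : r ∈ Complex.slitPlane := by
    have hn : 0 < Complex.normSq σ := Complex.normSq_pos.2 hσ0
    rw [Complex.mem_slitPlane_iff] at hσ ⊢
    rw [hr, Complex.re_ofReal_mul, Complex.im_ofReal_mul, Complex.inv_re, Complex.inv_im]
    exact hσ.imp (fun h => mul_pos hR (div_pos h hn))
      (fun h => mul_ne_zero hR.ne' (div_ne_zero (neg_ne_zero.2 h) hn.ne'))
  set β := Complex.sqrt r with hβ
  have hβre : 0 < β.re := Complex.sqrt_re_pos hrs
  have hβ2 : β ^ 2 = r := by
    rw [hβ, Complex.sqrt]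
    exact_mod_cast Complex.cpow_nat_inv_pow r two_ne_zero
  have hβ0 : β ≠ 0 := by intro h; simp [h] at hβre
  have hq : 0 < (β⁻¹).re := by
    rw [Complex.inv_re]
    exact div_pos hβre (Complex.normSq_pos.2 hβ0)
  set s : ℂ := -(Complex.I * (σ * ω)) with hs
  have hsre : 0 < s.re := by simpa [hs] using hσω
  have hrx (x : ℝ) (hx : 0 ≤ x) : r + x ≠ 0 := by
    intro h
    rcases Complex.mem_slitPlane_iff.1 hrs with h1 | h1
    · have := congrArg Complex.re h
      simp at this
      linarith
    · have := congrArg Complex.im h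
      simp at this
      exact h1 this
  set D : ℂ := -Complex.I / (σ * ω) with hD
  -- This `b` gives the segment part the same rate as the ray part.
  obtain ⟨C₁, hC₁, h₁⟩ := exists_radialSpace_segment_le hsre hq D hrx (2 * β.re * √2)
  obtain ⟨C₂, hC₂, h₂⟩ := exists_radialSpace_ray_le hβre D
  refine ⟨1, C₁ + C₂, one_pos, by positivity, fun N => ?_⟩
  obtain ⟨u₁, hu₁, hle₁⟩ := h₁ N
  obtain ⟨u₂, hu₂, hle₂⟩ := h₂ N
  have hN : (0 : ℝ) < 2 * ((N : ℝ) + 1) := by positivity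
  have hre : (Complex.sqrt (2 * (R : ℂ) * ((N : ℂ) + 1) / σ)).re = √(2 * ((N : ℝ) + 1)) * β.re := by
    have : 2 * (R : ℂ) * ((N : ℂ) + 1) / σ = ((2 * ((N : ℝ) + 1) : ℝ) : ℂ) * r := by
      rw [hr]; push_cast; ring
    rw [this, Complex.sqrt_ofReal_mul hN hr0, Complex.re_ofReal_mul]
  have hm₁ : AEStronglyMeasurable (fun x : ℝ => D * ((Complex.exp (-(s * (r + x))) -
      Complex.exp (-(β⁻¹ * (r + x)))) / (r + x)) - u₁ x) (volume.restrict (Set.Ici (0 : ℝ))) :=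
    AEStronglyMeasurable.sub (Measurable.aestronglyMeasurable (by fun_prop))
      (aestronglyMeasurable_of_mem_radialSpace hu₁ _)
  have hm₂ : AEStronglyMeasurable (fun x : ℝ => D * (Complex.exp (-(β⁻¹ * (β ^ 2 + x))) /
      (β ^ 2 + x)) - u₂ x) (volume.restrict (Set.Ici (0 : ℝ))) :=
    AEStronglyMeasurable.sub (Measurable.aestronglyMeasurable (by fun_prop))
      (aestronglyMeasurable_of_mem_radialSpace hu₂ _)
  calc bestApproxError N (fun x : ℝ => sphericalHankel 0 (ω * ((R : ℂ) + σ * (x : ℂ))))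
      ≤ eLpNorm (fun x : ℝ => sphericalHankel 0 (ω * ((R : ℂ) + σ * (x : ℂ))) - (u₁ + u₂) x) 2
          (volume.restrict (Set.Ici (0 : ℝ))) := iInf₂_le _ (Submodule.add_mem _ hu₁ hu₂)
    _ = _ := eLpNorm_congr_ae (by
        filter_upwards [ae_restrict_mem measurableSet_Ici] with x hx
        have hne := hrx x hx
        have e1 : ω * ((R : ℂ) + σ * x) = σ * ω * (r + x) := by
          rw [hr]; field_simp
        have e2 : Complex.I * (σ * ω * (r + x)) = -(s * (r + x)) := by rw [hs]; ring
        rw [Pi.add_apply, Pi.add_apply, hβ2, e1, sphericalHankel, e2, hD]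
        simp only [pow_zero, Nat.sub_zero, zero_add, Finset.range_one, Finset.sum_singleton,
          Nat.factorial_zero, Nat.cast_one, mul_one, div_one]
        field_simp
        ring)
    _ ≤ _ := (eLpNorm_add_le hm₁ hm₂ one_le_two).trans (add_le_add hle₁ hle₂)
    _ = ENNReal.ofReal ((C₁ + C₂) * Real.exp (-2 * (√(2 * ((N : ℝ) + 1)) * β.re))) := by
        rw [← ENNReal.ofReal_add (by positivity) (by positivity)]
        congr 1
        rw [Real.sqrt_mul zero_le_two]
        ring_nf
    _ ≤ _ := by
        rw [hre]
        exact ENNReal.ofReal_le_ofReal (le_add_of_nonneg_left (by positivity))
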